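/- Let $\mathbb{K}$ be a field of positive characteristic, with algebraic closure $\overline{\mathbb{K}}$, and let $\mathcal{S}\subset\mathbb{P}^3$ be a cubic surface given by a homogeneous polynomial $F\in\mathbb{K}[X_0,X_1,X_2,X_3]$ of degree $3$ that is absolutely irreducible, i.e. irreducible over $\overline{\mathbb{K}}$. A point $P\in\mathbb{P}^3(\overline{\mathbb{K}})$ is singular on $\mathcal{S}$ if $F$ and all its first partial derivatives vanish at $P$. Suppose that $\mathcal{S}$ has non-isolated singularities: some singular point of $\mathcal{S}$ over $\overline{\mathbb{K}}$ is not isolated in the set of singular points, for the Zariski topology. Then there is a line $\ell\subset\mathbb{P}^3$ defined over $\overline{\mathbb{K}}$ which is a double line of $\mathcal{S}$, i.e. $\mathcal{S}$ has multiplicity exactly $2$ along $\ell$ (equivalently $F\in I(\ell)^2\setminus I(\ell)^3$, where $I(\ell)\subset\overline{\mathbb{K}}[X_0,\dots,X_3]$ is the ideal of $\ell$), and all the singular points of $\mathcal{S}$ in $\mathbb{P}^3(\overline{\mathbb{K}})$ lie on $\ell$. -/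

import Mathlib

open MvPolynomial
open scoped LinearAlgebra.Projectivization

namespace CubicSurface

variable {k : Type*} [Field k]

/-- Points of projective 3-space with coordinates in the field `k`. -/
abbrev P3 (k : Type*) [Field k] : Type _ := ℙ k (Fin 4 → k)

/-- `P` is a singular point of the hypersurface `F = 0`: the form `F` and all its partial
derivatives vanish at `P`. For a form `F` this does not depend on the representative of `P`. -/
def IsSingularPoint (F : MvPolynomial (Fin 4) k) (P : P3 k) : Prop :=
  eval P.rep F = 0 ∧ ∀ i : Fin 4, eval P.rep (pderiv i F) = 0

/-- `P` is a non-isolated singular point of `F = 0`: it is singular, and each basic Zariski-open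
neighbourhood `G ≠ 0` of `P` (`G` a form of any degree) contains another singular point. -/
def IsNonisolatedSingularPoint (F : MvPolynomial (Fin 4) k) (P : P3 k) : Prop :=
  IsSingularPoint F P ∧
    ∀ (d : ℕ) (G : MvPolynomial (Fin 4) k), G.IsHomogeneous d → eval P.rep G ≠ 0 →
      ∃ Q : P3 k, Q ≠ P ∧ IsSingularPoint F Q ∧ eval Q.rep G ≠ 0

/-- The surface `F = 0` has non-isolated singularities. -/
def HasNonisolatedSingularities (F : MvPolynomial (Fin 4) k) : Prop :=
  ∃ P : P3 k, IsNonisolatedSingularPoint F P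

/-- A line of projective 3-space, given by the plane through the origin in `k⁴` (`cone`)
which it projectivizes. -/
structure Line (k : Type*) [Field k] where
  cone : Submodule k (Fin 4 → k)
  finrank_cone : Module.finrank k cone = 2

namespace Line

/-- The point `P` lies on the line `l`. -/
def Contains (l : Line k) (P : P3 k) : Prop := P.submodule ≤ l.cone

/-- The ideal of all polynomials vanishing on the affine cone over the line `l`; over an infinite
field this is the homogeneous ideal of `l`, generated by two independent linear forms. -/
def ideal (l : Line k) : Ideal (MvPolynomial (Fin 4) k) :=
  vanishingIdeal k (l.cone : Set (Fin 4 → k))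

end Line

/-- The surface `F = 0` has multiplicity `m` along the line `l`. Since the ideal of `l` is generated
by a regular sequence, its powers agree with its symbolic powers, so this is the order
of vanishing of `F` at the generic point of `l`. -/
def HasMultiplicityAlong (F : MvPolynomial (Fin 4) k) (l : Line k) (m : ℕ) : Prop :=
  F ∈ l.ideal ^ m ∧ F ∉ l.ideal ^ (m + 1)

/-- `l` is a double line of the surface `F = 0`. -/
def IsDoubleLine (F : MvPolynomial (Fin 4) k) (l : Line k) : Prop :=
  HasMultiplicityAlong F l 2

end CubicSurface

/-! Write the cubic as `v ↦ B v v v` with `B` trilinear but not symmetric, so that nothing is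
divided by 2 or 3. On the plane of three non-collinear singular points only the monomial `abc`
survives, with coefficient `polar`; if it vanished, the plane would split off
(`Represents.polar_ne_zero`). So it is nonzero, and the plane contains no further singular point. A
fourth one therefore completes a tetrahedron, and the surface is Cayley's four-nodal cubic, singular
only at the vertices. Having infinitely many singular points, the surface must have them all on one
line, and three of them make the whole line singular (`Represents.exists_singular_line`). A singular
line puts `F` in the square of its ideal; in the cube, `F` would be a binary cubic, hence reducible.
-/

namespace CubicSurface

/-! ### Polarization of a cubic map and its singular vectors -/

section Polarization

variable {k V : Type*} [Field k] [AddCommGroup V] [Module k V]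

/-- The derivative at `v` in direction `w` of the cubic map `v ↦ B v v v`. -/
def cubicDeriv (B : V →ₗ[k] V →ₗ[k] V →ₗ[k] k) (v w : V) : k :=
  B w v v + B v w v + B v v w

/-- The full polarization of the cubic map `v ↦ B v v v`. -/
def polar (B : V →ₗ[k] V →ₗ[k] V →ₗ[k] k) (u v w : V) : k :=
  B u v w + B u w v + B v u w + B v w u + B w u v + B w v u

/-- `v` is a singular zero of the cubic map `v ↦ B v v v`. -/
def IsSingularVector (B : V →ₗ[k] V →ₗ[k] V →ₗ[k] k) (v : V) : Prop :=
  B v v v = 0 ∧ ∀ w, cubicDeriv B v w = 0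

variable {B : V →ₗ[k] V →ₗ[k] V →ₗ[k] k}

theorem cubic_combination (s₀ s₁ s₂ s₃ : k) (b₀ b₁ b₂ b₃ : V) :
    (fun v => B v v v) (s₀ • b₀ + s₁ • b₁ + s₂ • b₂ + s₃ • b₃) =
      B b₀ b₀ b₀ * s₀ ^ 3 + B b₁ b₁ b₁ * s₁ ^ 3 + B b₂ b₂ b₂ * s₂ ^ 3 + B b₃ b₃ b₃ * s₃ ^ 3 +
      cubicDeriv B b₀ b₁ * s₀ ^ 2 * s₁ + cubicDeriv B b₀ b₂ * s₀ ^ 2 * s₂ +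
      cubicDeriv B b₀ b₃ * s₀ ^ 2 * s₃ + cubicDeriv B b₁ b₀ * s₁ ^ 2 * s₀ +
      cubicDeriv B b₁ b₂ * s₁ ^ 2 * s₂ + cubicDeriv B b₁ b₃ * s₁ ^ 2 * s₃ +
      cubicDeriv B b₂ b₀ * s₂ ^ 2 * s₀ + cubicDeriv B b₂ b₁ * s₂ ^ 2 * s₁ +
      cubicDeriv B b₂ b₃ * s₂ ^ 2 * s₃ + cubicDeriv B b₃ b₀ * s₃ ^ 2 * s₀ +
      cubicDeriv B b₃ b₁ * s₃ ^ 2 * s₁ + cubicDeriv B b₃ b₂ * s₃ ^ 2 * s₂ +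
      polar B b₀ b₁ b₂ * s₀ * s₁ * s₂ + polar B b₀ b₁ b₃ * s₀ * s₁ * s₃ +
      polar B b₀ b₂ b₃ * s₀ * s₂ * s₃ + polar B b₁ b₂ b₃ * s₁ * s₂ * s₃ := by
  simp only [cubicDeriv, polar, map_add, map_smul, LinearMap.add_apply, LinearMap.smul_apply,
    smul_eq_mul]
  ring

theorem cubicDeriv_combination (s₀ s₁ s₂ s₃ : k) (b₀ b₁ b₂ b₃ w : V) :
    cubicDeriv B (s₀ • b₀ + s₁ • b₁ + s₂ • b₂ + s₃ • b₃) w =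
      cubicDeriv B b₀ w * s₀ ^ 2 + cubicDeriv B b₁ w * s₁ ^ 2 + cubicDeriv B b₂ w * s₂ ^ 2 +
      cubicDeriv B b₃ w * s₃ ^ 2 + polar B b₀ b₁ w * s₀ * s₁ + polar B b₀ b₂ w * s₀ * s₂ +
      polar B b₀ b₃ w * s₀ * s₃ + polar B b₁ b₂ w * s₁ * s₂ + polar B b₁ b₃ w * s₁ * s₃ +
      polar B b₂ b₃ w * s₂ * s₃ := by
  simp only [cubicDeriv, polar, map_add, map_smul, LinearMap.add_apply, LinearMap.smul_apply,
    smul_eq_mul]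
  ring

theorem polar_swap_left (u v w : V) : polar B u v w = polar B v u w := by
  simp only [polar]
  ring

theorem polar_swap_right (u v w : V) : polar B u v w = polar B u w v := by
  simp only [polar]
  ring

/-- Repeating an argument in `polar` gives twice `cubicDeriv`. -/
theorem IsSingularVector.polar_eq_zero {v : V} (hv : IsSingularVector B v) (u : V) :
    polar B u v v = 0 ∧ polar B v u v = 0 ∧ polar B v v u = 0 := by
  have h : polar B u v v = 0 := by
    have h := hv.2 u
    simp only [polar, cubicDeriv] at h ⊢
    linear_combination 2 * h
  exact ⟨h, by rwa [polar_swap_left], by rwa [polar_swap_right, polar_swap_left]⟩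

/-- If four singular vectors have nonzero polarizations, any singular vector in their span lies on
a coordinate axis. -/
theorem IsSingularVector.axis_of_polar_ne_zero {b₀ b₁ b₂ b₃ : V} (h₀ : IsSingularVector B b₀)
    (h₁ : IsSingularVector B b₁) (h₂ : IsSingularVector B b₂) (h₃ : IsSingularVector B b₃)
    (h012 : polar B b₀ b₁ b₂ ≠ 0) (h013 : polar B b₀ b₁ b₃ ≠ 0) (h023 : polar B b₀ b₂ b₃ ≠ 0)
    (h123 : polar B b₁ b₂ b₃ ≠ 0) {s₀ s₁ s₂ s₃ : k}
    (hx : IsSingularVector B (s₀ • b₀ + s₁ • b₁ + s₂ • b₂ + s₃ • b₃)) :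
    (s₁ = 0 ∧ s₂ = 0 ∧ s₃ = 0) ∨ (s₀ = 0 ∧ s₂ = 0 ∧ s₃ = 0) ∨ (s₀ = 0 ∧ s₁ = 0 ∧ s₃ = 0) ∨
      (s₀ = 0 ∧ s₁ = 0 ∧ s₂ = 0) := by
  have hF := (cubic_combination (B := B) s₀ s₁ s₂ s₃ b₀ b₁ b₂ b₃).symm.trans hx.1
  have d₀ := hx.2 b₀
  have d₁ := hx.2 b₁
  have d₂ := hx.2 b₂
  have d₃ := hx.2 b₃
  rw [cubicDeriv_combination] at d₀ d₁ d₂ d₃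
  simp only [h₀.1, h₁.1, h₂.1, h₃.1, h₀.2, h₁.2, h₂.2, h₃.2, h₀.polar_eq_zero, h₁.polar_eq_zero,
    h₂.polar_eq_zero, h₃.polar_eq_zero, zero_mul, zero_add, add_zero] at hF d₀ d₁ d₂ d₃
  have e₁ : polar B b₁ b₂ b₀ = polar B b₀ b₁ b₂ := by simp only [polar]; ring
  have e₂ : polar B b₁ b₃ b₀ = polar B b₀ b₁ b₃ := by simp only [polar]; ring
  have e₃ : polar B b₂ b₃ b₀ = polar B b₀ b₂ b₃ := by simp only [polar]; ring
  have e₄ : polar B b₂ b₃ b₁ = polar B b₁ b₂ b₃ := by simp only [polar]; ring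
  rw [e₁, e₂, e₃] at d₀
  rw [polar_swap_right b₀ b₂ b₁, polar_swap_right b₀ b₃ b₁, e₄] at d₁
  rw [polar_swap_right b₀ b₃ b₂, polar_swap_right b₁ b₃ b₂] at d₂
  -- All surviving monomials are squarefree, so `s₀ * d₀` collects those containing `s₀`, and
  -- subtracting it from the cubic isolates the remaining one.
  have t₀ : s₁ * s₂ * s₃ = 0 := mul_left_cancel₀ h123 (by linear_combination hF - s₀ * d₀)
  have t₁ : s₀ * s₂ * s₃ = 0 := mul_left_cancel₀ h023 (by linear_combination hF - s₁ * d₁)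
  have t₂ : s₀ * s₁ * s₃ = 0 := mul_left_cancel₀ h013 (by linear_combination hF - s₂ * d₂)
  have t₃ : s₀ * s₁ * s₂ = 0 := mul_left_cancel₀ h012 (by linear_combination hF - s₃ * d₃)
  grind

/-- If three singular vectors have nonzero polarization, any singular vector in their span lies on
a coordinate axis. -/
theorem IsSingularVector.axis_of_polar_ne_zero_three {u v w : V} (hu : IsSingularVector B u)
    (hv : IsSingularVector B v) (hw : IsSingularVector B w) (h : polar B u v w ≠ 0) {a b c : k}
    (hx : IsSingularVector B (a • u + b • v + c • w)) :
    (b = 0 ∧ c = 0) ∨ (a = 0 ∧ c = 0) ∨ (a = 0 ∧ b = 0) := by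
  have hD : ∀ x, cubicDeriv B (a • u + b • v + c • w) x =
      polar B u v x * a * b + polar B u w x * a * c + polar B v w x * b * c := by
    intro x
    have h := cubicDeriv_combination (B := B) a b c 0 u v w 0 x
    simpa [hu.2, hv.2, hw.2] using h
  -- These are the partial derivatives of `polar B u v w * a * b * c`.
  have d₁ := hx.2 u
  have d₂ := hx.2 v
  have d₃ := hx.2 w
  rw [hD] at d₁ d₂ d₃
  have e₁ : polar B v w u = polar B u v w := by simp only [polar]; ring
  simp only [e₁, polar_swap_right u w v, hu.polar_eq_zero, hv.polar_eq_zero, hw.polar_eq_zero,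
    zero_mul, zero_add, add_zero] at d₁ d₂ d₃
  grind

/-- A singular vector in the span of two others which is on neither axis makes the whole span
singular. -/
theorem IsSingularVector.combination {u v : V} (hu : IsSingularVector B u)
    (hv : IsSingularVector B v) {a b : k} (ha : a ≠ 0) (hb : b ≠ 0)
    (hx : IsSingularVector B (a • u + b • v)) (c d : k) : IsSingularVector B (c • u + d • v) := by
  have hD : ∀ c d w, cubicDeriv B (c • u + d • v) w = polar B u v w * c * d := by
    intro c d w
    have h := cubicDeriv_combination (B := B) c d 0 0 u v 0 0 w
    simpa [hu.2, hv.2] using h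
  have h₀ : ∀ w, polar B u v w = 0 := by
    intro w
    have h := hx.2 w
    rw [hD] at h
    grind
  refine ⟨?_, fun w => by rw [hD, h₀]; ring⟩
  have h := cubic_combination (B := B) c d 0 0 u v 0 0
  simpa [hu.1, hv.1, hu.2, hv.2] using h

end Polarization

/-! ### Cubic forms as trilinear maps -/

section CubicForm

variable {k : Type*} [Field k]

/-- The linear form given by a linear functional on `k⁴`. -/
noncomputable def linForm (f : Module.Dual k (Fin 4 → k)) : MvPolynomial (Fin 4) k :=
  ∑ i, C (f (Pi.single i 1)) * X i

@[simp]
theorem eval_linForm (f : Module.Dual k (Fin 4 → k)) (v : Fin 4 → k) :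
    eval v (linForm f) = f v := by
  conv_rhs => rw [pi_eq_sum_univ' v]
  simp [linForm, mul_comm]

theorem isHomogeneous_linForm (f : Module.Dual k (Fin 4 → k)) : (linForm f).IsHomogeneous 1 :=
  IsHomogeneous.sum _ _ _ fun i _ => by simpa using (isHomogeneous_C _ _).mul (isHomogeneous_X k i)

/-- `B` is a trilinear map inducing the cubic form `F` and its derivatives. -/
structure Represents (B : (Fin 4 → k) →ₗ[k] (Fin 4 → k) →ₗ[k] (Fin 4 → k) →ₗ[k] k)
    (F : MvPolynomial (Fin 4) k) : Prop where
  eval_eq : ∀ v, eval v F = B v v v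
  eval_pderiv : ∀ v w, ∑ i, w i * eval v (pderiv i F) = cubicDeriv B v w

/-- A monomial is a product of three coordinates, which is a trilinear map once each coordinate gets
its own argument. -/
theorem exists_represents_monomial {d : Fin 4 →₀ ℕ} (hd : d.degree = 3) (c : k) :
    ∃ B, Represents B (monomial d c) := by
  have key : ∀ (n : ℕ) (e : Fin 4 →₀ ℕ), e.degree = n + 1 →
      ∃ i e', e'.degree = n ∧ e = e' + Finsupp.single i 1 := by
    intro n e he
    have : e ≠ 0 := by rintro rfl; simp at he
    obtain ⟨i, hi⟩ := Finsupp.ne_iff.1 this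
    have hle : Finsupp.single i 1 ≤ e := by
      rw [Finsupp.single_le_iff]; exact Nat.one_le_iff_ne_zero.2 hi
    have h := tsub_add_cancel_of_le hle
    refine ⟨i, _, ?_, h.symm⟩
    rw [← h, map_add] at he
    simpa using he
  obtain ⟨i, d₁, h₁, rfl⟩ := key 2 d hd
  obtain ⟨j, d₂, h₂, rfl⟩ := key 1 d₁ h₁
  obtain ⟨l, d₃, h₃, rfl⟩ := key 0 d₂ h₂
  obtain rfl : d₃ = 0 := (Finsupp.degree_eq_zero_iff d₃).1 h₃
  have hF : monomial (0 + Finsupp.single l 1 + Finsupp.single j 1 + Finsupp.single i 1) c =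
      C c * X l * X j * X i := by
    simp only [X, C_apply, monomial_mul, mul_one]
  rw [hF]
  let π : Fin 4 → ((Fin 4 → k) →ₗ[k] k) := fun i => LinearMap.proj i
  refine ⟨(π l).smulRight ((π j).smulRight (c • π i)), fun v => ?_, fun v w => ?_⟩
  · simp [π]; ring
  · have h : ∀ m, eval v (pderiv m (C c * X l * X j * X i)) =
        c * ((if m = l then 1 else 0) * v j * v i + v l * (if m = j then 1 else 0) * v i +
          v l * v j * (if m = i then 1 else 0)) := by
      intro m
      simp [pderiv_X, Pi.single_apply, eq_comm (a := m)]
      split_ifs <;> simp <;> ring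
    simp only [h, mul_add, mul_ite, ite_mul, mul_one, mul_zero, one_mul, zero_mul,
      Finset.sum_add_distrib, Finset.sum_ite_eq', Finset.mem_univ, if_true]
    simp [π, cubicDeriv]
    ring

theorem exists_represents {F : MvPolynomial (Fin 4) k} (hF : F.IsHomogeneous 3) :
    ∃ B, Represents B F := by
  have h : ∀ d : Fin 4 →₀ ℕ, ∃ B, Represents B (monomial d (coeff d F)) := by
    intro d
    by_cases hd : coeff d F = 0
    · refine ⟨0, fun v => by simp [hd], fun v w => by simp [hd, cubicDeriv]⟩
    · refine exists_represents_monomial ?_ _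
      rw [← hF hd, Finsupp.degree_eq_weight_one]
      rfl
  choose B hB using h
  refine ⟨∑ d ∈ F.support, B d, fun v => ?_, fun v w => ?_⟩
  · conv_lhs => rw [F.as_sum]
    simp only [map_sum, LinearMap.sum_apply, (hB _).eval_eq]
  · conv_lhs => rw [F.as_sum]
    simp only [cubicDeriv, map_sum, LinearMap.sum_apply, ← Finset.sum_add_distrib, Finset.mul_sum]
    rw [Finset.sum_comm]
    exact Finset.sum_congr rfl fun d _ => (hB d).eval_pderiv v w

theorem Represents.isSingularPoint_iff {B : (Fin 4 → k) →ₗ[k] (Fin 4 → k) →ₗ[k] (Fin 4 → k) →ₗ[k] k}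
    {F : MvPolynomial (Fin 4) k} (hB : Represents B F) {P : P3 k} :
    IsSingularPoint F P ↔ IsSingularVector B P.rep := by
  refine and_congr (by rw [hB.eval_eq]) ⟨fun h w => ?_, fun h i => ?_⟩
  · rw [← hB.eval_pderiv]; simp [h]
  · simpa [← hB.eval_pderiv, Pi.single_apply] using h (Pi.single i 1)

@[simp]
theorem constantCoeff_linForm (f : Module.Dual k (Fin 4 → k)) : constantCoeff (linForm f) = 0 := by
  simp [linForm]

/-- A polynomial that is a product of two factors vanishing at the origin is not irreducible. -/
theorem not_irreducible_of_mul {F L Q : MvPolynomial (Fin 4) k} (h : F = L * Q)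
    (hL : constantCoeff L = 0) (hQ : constantCoeff Q = 0) : ¬ Irreducible F := by
  intro hF
  rcases hF.isUnit_or_isUnit h with hu | hu
  · exact (hu.map constantCoeff).ne_zero hL
  · exact (hu.map constantCoeff).ne_zero hQ

theorem exists_linearIndependent_cons {n : ℕ} (hn : n < 4) {v : Fin n → Fin 4 → k}
    (hv : LinearIndependent k v) :
    ∃ x, LinearIndependent k (Matrix.vecCons x v) := by
  have : Submodule.span k (Set.range v) ≠ ⊤ := by
    intro ht
    have := finrank_span_eq_card hv
    rw [ht] at this
    simp at this
    omega
  obtain ⟨x, -, hx⟩ := SetLike.exists_of_lt this.lt_top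
  exact ⟨x, hv.finCons hx⟩

theorem eq_of_rep_eq_smul {P Q : P3 k} {a : k} (h : P.rep = a • Q.rep) : P = Q := by
  rw [← P.mk_rep, ← Q.mk_rep]
  exact (Projectivization.mk_eq_mk_iff' _ _ _ _ _).2 ⟨a, h.symm⟩

theorem linearIndependent_rep_pair {P Q : P3 k} (h : P ≠ Q) :
    LinearIndependent k ![P.rep, Q.rep] := by
  have := Projectivization.independent_iff.1 ((Projectivization.independent_pair_iff_ne P Q).2 h)
  have hr : Projectivization.rep ∘ ![P, Q] = ![P.rep, Q.rep] := by
    ext i : 1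
    fin_cases i <;> rfl
  rwa [hr] at this

/-! ### Infinitude of singular points and splitting of binary cubics -/

/-- A surface with a non-isolated singular point has infinitely many singular points. -/
theorem HasNonisolatedSingularities.infinite {F : MvPolynomial (Fin 4) k}
    (h : HasNonisolatedSingularities F) : {P : P3 k | IsSingularPoint F P}.Infinite := by
  classical
  obtain ⟨P, -, hP⟩ := h
  intro hfin
  -- A plane through `Q` missing `P`; were the singular points finite in number, the product of
  -- these planes would isolate `P`.
  have key : ∀ Q : P3 k, ∃ f : Module.Dual k (Fin 4 → k), Q ≠ P → f Q.rep = 0 ∧ f P.rep ≠ 0 := by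
    intro Q
    by_cases hQ : Q = P
    · exact ⟨0, fun h => (h hQ).elim⟩
    have hmem : P.rep ∉ Submodule.span k {Q.rep} := by
      intro hmem
      obtain ⟨a, ha⟩ := Submodule.mem_span_singleton.1 hmem
      exact hQ (eq_of_rep_eq_smul ha.symm).symm
    obtain ⟨f, hf, hle⟩ := Submodule.exists_le_ker_of_notMem hmem
    exact ⟨f, fun _ => ⟨hle (Submodule.mem_span_singleton_self _), hf⟩⟩
  choose f hf using key
  obtain ⟨Q, hQP, hQ, hG⟩ := hP _ (∏ Q ∈ hfin.toFinset.erase P, linForm (f Q))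
    (IsHomogeneous.prod _ _ _ fun Q _ => isHomogeneous_linForm (f Q)) (by
      rw [map_prod, Finset.prod_ne_zero_iff]
      intro Q hQ
      rw [eval_linForm]
      exact (hf Q (Finset.ne_of_mem_erase hQ)).2)
  refine hG ?_
  rw [map_prod]
  exact Finset.prod_eq_zero (Finset.mem_erase.2 ⟨hQP, hfin.mem_toFinset.2 hQ⟩)
    (by rw [eval_linForm]; exact (hf Q hQP).1)

theorem not_irreducible_binary_cubic [IsAlgClosed k] {F : MvPolynomial (Fin 4) k}
    (f g : Module.Dual k (Fin 4 → k))
    (a₀ a₁ a₂ a₃ : k) (hF : F = C a₀ * linForm f ^ 3 + C a₁ * linForm f ^ 2 * linForm g +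
      C a₂ * linForm f * linForm g ^ 2 + C a₃ * linForm g ^ 3) : ¬ Irreducible F := by
  by_cases ha : a₀ = 0
  · refine not_irreducible_of_mul (L := linForm g) (Q := C a₁ * linForm f ^ 2 +
      C a₂ * linForm f * linForm g + C a₃ * linForm g ^ 2) ?_ (by simp) (by simp)
    rw [hF, ha, map_zero]
    ring
  -- A root `t` of the dehomogenized cubic gives the factor `f - t g`.
  · obtain ⟨t, ht⟩ := IsAlgClosed.exists_root (Polynomial.C a₀ * Polynomial.X ^ 3 +
      Polynomial.C a₁ * Polynomial.X ^ 2 + Polynomial.C a₂ * Polynomial.X + Polynomial.C a₃)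
      (by rw [Polynomial.degree_cubic ha]; norm_num)
    simp only [Polynomial.IsRoot, Polynomial.eval_add, Polynomial.eval_mul, Polynomial.eval_C,
      Polynomial.eval_pow, Polynomial.eval_X] at ht
    have ha₃ : a₃ = -(a₀ * t ^ 3 + a₁ * t ^ 2 + a₂ * t) := by linear_combination ht
    refine not_irreducible_of_mul (L := linForm f - C t * linForm g)
      (Q := C a₀ * linForm f ^ 2 + C (a₀ * t + a₁) * linForm f * linForm g +
        C (a₀ * t ^ 2 + a₁ * t + a₂) * linForm g ^ 2) ?_ (by simp) (by simp)
    rw [hF, ha₃]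
    simp only [map_neg, map_add, map_mul, map_pow]
    ring

/-! ### Coordinates adapted to singular points, and the singular line -/

variable [Infinite k] {B : (Fin 4 → k) →ₗ[k] (Fin 4 → k) →ₗ[k] (Fin 4 → k) →ₗ[k] k}
  {F : MvPolynomial (Fin 4) k}

theorem Represents.eq_combination (hB : Represents B F) (b : Module.Basis (Fin 4) k (Fin 4 → k)) :
    F = C (B (b 0) (b 0) (b 0)) * linForm (b.coord 0) ^ 3 +
      C (B (b 1) (b 1) (b 1)) * linForm (b.coord 1) ^ 3 +
      C (B (b 2) (b 2) (b 2)) * linForm (b.coord 2) ^ 3 +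
      C (B (b 3) (b 3) (b 3)) * linForm (b.coord 3) ^ 3 +
      C (cubicDeriv B (b 0) (b 1)) * linForm (b.coord 0) ^ 2 * linForm (b.coord 1) +
      C (cubicDeriv B (b 0) (b 2)) * linForm (b.coord 0) ^ 2 * linForm (b.coord 2) +
      C (cubicDeriv B (b 0) (b 3)) * linForm (b.coord 0) ^ 2 * linForm (b.coord 3) +
      C (cubicDeriv B (b 1) (b 0)) * linForm (b.coord 1) ^ 2 * linForm (b.coord 0) +
      C (cubicDeriv B (b 1) (b 2)) * linForm (b.coord 1) ^ 2 * linForm (b.coord 2) +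
      C (cubicDeriv B (b 1) (b 3)) * linForm (b.coord 1) ^ 2 * linForm (b.coord 3) +
      C (cubicDeriv B (b 2) (b 0)) * linForm (b.coord 2) ^ 2 * linForm (b.coord 0) +
      C (cubicDeriv B (b 2) (b 1)) * linForm (b.coord 2) ^ 2 * linForm (b.coord 1) +
      C (cubicDeriv B (b 2) (b 3)) * linForm (b.coord 2) ^ 2 * linForm (b.coord 3) +
      C (cubicDeriv B (b 3) (b 0)) * linForm (b.coord 3) ^ 2 * linForm (b.coord 0) +
      C (cubicDeriv B (b 3) (b 1)) * linForm (b.coord 3) ^ 2 * linForm (b.coord 1) +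
      C (cubicDeriv B (b 3) (b 2)) * linForm (b.coord 3) ^ 2 * linForm (b.coord 2) +
      C (polar B (b 0) (b 1) (b 2)) * linForm (b.coord 0) * linForm (b.coord 1) *
        linForm (b.coord 2) +
      C (polar B (b 0) (b 1) (b 3)) * linForm (b.coord 0) * linForm (b.coord 1) *
        linForm (b.coord 3) +
      C (polar B (b 0) (b 2) (b 3)) * linForm (b.coord 0) * linForm (b.coord 2) *
        linForm (b.coord 3) +
      C (polar B (b 1) (b 2) (b 3)) * linForm (b.coord 1) * linForm (b.coord 2) *
        linForm (b.coord 3) := by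
  refine MvPolynomial.funext fun v => ?_
  rw [hB.eval_eq]
  have hv : b.coord 0 v • b 0 + b.coord 1 v • b 1 + b.coord 2 v • b 2 + b.coord 3 v • b 3 = v := by
    have h := b.sum_repr v
    rw [Fin.sum_univ_four] at h
    exact h
  have h := cubic_combination (B := B) (b.coord 0 v) (b.coord 1 v) (b.coord 2 v) (b.coord 3 v)
    (b 0) (b 1) (b 2) (b 3)
  rw [hv] at h
  simpa only [map_add, map_mul, map_pow, eval_C, eval_linForm] using h

/-- An irreducible cubic form does not vanish on the plane of three independent singular vectors. -/
theorem Represents.polar_ne_zero (hB : Represents B F) (hF : Irreducible F) {u v w : Fin 4 → k}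
    (hu : IsSingularVector B u) (hv : IsSingularVector B v) (hw : IsSingularVector B w)
    (hli : LinearIndependent k ![u, v, w]) : polar B u v w ≠ 0 := by
  intro h
  obtain ⟨x, hx⟩ := exists_linearIndependent_cons (by norm_num) hli
  let b := basisOfLinearIndependentOfCardEqFinrank hx (by simp)
  have hb : ⇑b = ![x, u, v, w] := coe_basisOfLinearIndependentOfCardEqFinrank _ _
  have hE := hB.eq_combination b
  have b₁ : b 1 = u := by simp [hb]
  have b₂ : b 2 = v := by simp [hb]
  have b₃ : b 3 = w := by simp [hb]
  simp only [b₁, b₂, b₃, h, hu.1, hv.1, hw.1, hu.2, hv.2, hw.2, map_zero, zero_mul, add_zero] at hE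
  -- Every remaining monomial contains the coordinate that vanishes on the plane.
  refine not_irreducible_of_mul (L := linForm (b.coord 0)) (Q := C (B (b 0) (b 0) (b 0)) *
    linForm (b.coord 0) ^ 2 + C (cubicDeriv B (b 0) u) * linForm (b.coord 0) * linForm (b.coord 1) +
    C (cubicDeriv B (b 0) v) * linForm (b.coord 0) * linForm (b.coord 2) +
    C (cubicDeriv B (b 0) w) * linForm (b.coord 0) * linForm (b.coord 3) +
    C (polar B (b 0) u v) * linForm (b.coord 1) * linForm (b.coord 2) +
    C (polar B (b 0) u w) * linForm (b.coord 1) * linForm (b.coord 3) +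
    C (polar B (b 0) v w) * linForm (b.coord 2) * linForm (b.coord 3)) ?_ (by simp) (by simp) hF
  rw [hE]
  ring

/-- Infinitely many singular points of an irreducible cubic surface fill a line. -/
theorem Represents.exists_singular_line (hB : Represents B F) (hF : Irreducible F)
    (hinf : {P : P3 k | IsSingularPoint F P}.Infinite) :
    ∃ u v : Fin 4 → k, LinearIndependent k ![u, v] ∧
      (∀ c d : k, IsSingularVector B (c • u + d • v)) ∧
      ∀ P : P3 k, IsSingularPoint F P → P.rep ∈ Submodule.span k {u, v} := by
  classical
  have next : ∀ s : Finset (P3 k), ∃ P ∉ s, IsSingularVector B P.rep := fun s => by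
    obtain ⟨P, hP, hs⟩ := hinf.exists_notMem_finset s
    exact ⟨P, hs, hB.isSingularPoint_iff.1 hP⟩
  obtain ⟨P₁, -, h₁⟩ := next ∅
  obtain ⟨P₂, hP₂, h₂⟩ := next {P₁}
  have hne : P₁ ≠ P₂ := fun h => hP₂ (by simp [h])
  have hli := linearIndependent_rep_pair hne
  by_cases hall : ∀ P : P3 k, IsSingularPoint F P → P.rep ∈ Submodule.span k {P₁.rep, P₂.rep}
  · refine ⟨P₁.rep, P₂.rep, hli, ?_, hall⟩
    obtain ⟨P₃, hP₃, h₃⟩ := next {P₁, P₂}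
    simp only [Finset.mem_insert, Finset.mem_singleton, not_or] at hP₃
    obtain ⟨a, b, hab⟩ := Submodule.mem_span_pair.1 (hall P₃ (hB.isSingularPoint_iff.2 h₃))
    have ha : a ≠ 0 := by
      rintro rfl
      exact hP₃.2 (eq_of_rep_eq_smul (a := b) (by simp [← hab]))
    have hb : b ≠ 0 := by
      rintro rfl
      exact hP₃.1 (eq_of_rep_eq_smul (a := a) (by simp [← hab]))
    rw [← hab] at h₃
    exact h₁.combination h₂ ha hb h₃
  · exfalso
    push Not at hall
    obtain ⟨P₃, hs₃, hP₃⟩ := hall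
    have h₃ := hB.isSingularPoint_iff.1 hs₃
    have hli₃ : LinearIndependent k ![P₃.rep, P₁.rep, P₂.rep] := by
      refine hli.finCons ?_
      simpa [Matrix.range_cons, Set.pair_comm] using hP₃
    have hp := hB.polar_ne_zero hF h₃ h₁ h₂ hli₃
    obtain ⟨P₄, hP₄, h₄⟩ := next {P₁, P₂, P₃}
    simp only [Finset.mem_insert, Finset.mem_singleton, not_or] at hP₄
    -- A singular point in the plane of the first three would be one of them.
    have hli₄ : LinearIndependent k ![P₄.rep, P₃.rep, P₁.rep, P₂.rep] := by
      refine hli₃.finCons fun hmem => ?_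
      obtain ⟨c, hc⟩ := (Submodule.mem_span_range_iff_exists_fun k).1 hmem
      simp only [Fin.sum_univ_three, Matrix.cons_val] at hc
      have h₅ := h₄
      rw [← hc] at h₅
      rcases h₃.axis_of_polar_ne_zero_three h₁ h₂ hp h₅ with h | h | h
      · exact hP₄.2.2 (eq_of_rep_eq_smul (a := c 0) (hc.symm.trans (by simp [h])))
      · exact hP₄.1 (eq_of_rep_eq_smul (a := c 1) (hc.symm.trans (by simp [h])))
      · exact hP₄.2.1 (eq_of_rep_eq_smul (a := c 2) (hc.symm.trans (by simp [h])))
    have sub : ∀ f : Fin 3 → Fin 4, Function.Injective f →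
        LinearIndependent k (![P₄.rep, P₃.rep, P₁.rep, P₂.rep] ∘ f) := fun f hf => hli₄.comp f hf
    have hp₁ := hB.polar_ne_zero hF h₄ h₃ h₁
      (by convert sub ![0, 1, 2] (by decide) using 1; ext i : 1; fin_cases i <;> rfl)
    have hp₂ := hB.polar_ne_zero hF h₄ h₃ h₂
      (by convert sub ![0, 1, 3] (by decide) using 1; ext i : 1; fin_cases i <;> rfl)
    have hp₃ := hB.polar_ne_zero hF h₄ h₁ h₂
      (by convert sub ![0, 2, 3] (by decide) using 1; ext i : 1; fin_cases i <;> rfl)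
    -- All four coefficients of Cayley's cubic are nonzero, so a fifth singular point has to be a
    -- vertex.
    obtain ⟨P₅, hP₅, h₅⟩ := next {P₁, P₂, P₃, P₄}
    simp only [Finset.mem_insert, Finset.mem_singleton, not_or] at hP₅
    let b := basisOfLinearIndependentOfCardEqFinrank hli₄ (by simp)
    have hb : ⇑b = ![P₄.rep, P₃.rep, P₁.rep, P₂.rep] :=
      coe_basisOfLinearIndependentOfCardEqFinrank _ _
    have hc := b.sum_repr P₅.rep
    simp only [Fin.sum_univ_four, hb, Matrix.cons_val] at hc
    have h₆ := h₅
    rw [← hc] at h₆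
    rcases h₄.axis_of_polar_ne_zero h₃ h₁ h₂ hp₁ hp₂ hp₃ hp h₆ with h | h | h | h
    · exact hP₅.2.2.2 (eq_of_rep_eq_smul (a := b.repr P₅.rep 0) (hc.symm.trans (by simp [h])))
    · exact hP₅.2.2.1 (eq_of_rep_eq_smul (a := b.repr P₅.rep 1) (hc.symm.trans (by simp [h])))
    · exact hP₅.1 (eq_of_rep_eq_smul (a := b.repr P₅.rep 2) (hc.symm.trans (by simp [h])))
    · exact hP₅.2.1 (eq_of_rep_eq_smul (a := b.repr P₅.rep 3) (hc.symm.trans (by simp [h])))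

/-! ### Multiplicity along the line -/

/-- A cubic form vanishing to order three along a line has vanishing values and derivatives at the
points and in the directions of that line. -/
theorem Represents.eq_zero_of_mem_ideal_cube (hB : Represents B F) {l : Line k}
    (hF : F ∈ l.ideal ^ 3) {q : Fin 4 → k} (hq : q ∈ l.cone) (w : Fin 4 → k) :
    B q q q = 0 ∧ cubicDeriv B q w = 0 ∧ cubicDeriv B w q = 0 := by
  -- Restriction to `q + t w`, which sends the ideal of `l` into `(X)`; the claims are the
  -- coefficients of `1`, `X`, `X ^ 2`.
  let ψ : MvPolynomial (Fin 4) k →ₐ[k] Polynomial k :=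
    aeval fun i => Polynomial.C (q i) + Polynomial.X * Polynomial.C (w i)
  have hψ : ∀ (G : MvPolynomial (Fin 4) k) (t : k), (ψ G).eval t = eval (q + t • w) G := by
    intro G t
    have : (Polynomial.aeval t).comp ψ = aeval (q + t • w) := by
      ext i
      simp [ψ, mul_comm t]
    simpa [Polynomial.aeval_def, Polynomial.eval₂_eq_eval_map] using DFunLike.congr_fun this G
  have hI : l.ideal.map ψ ≤ Ideal.span {Polynomial.X} := by
    refine Ideal.map_le_iff_le_comap.2 fun G hG => ?_
    rw [Ideal.mem_comap, Ideal.mem_span_singleton, Polynomial.X_dvd_iff,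
      Polynomial.coeff_zero_eq_eval_zero, hψ]
    simpa using mem_vanishingIdeal_iff.1 hG q hq
  have h3 : Polynomial.X ^ 3 ∣ ψ F := by
    rw [← Ideal.mem_span_singleton, ← Ideal.span_singleton_pow]
    refine Ideal.pow_right_mono hI 3 ?_
    rw [← Ideal.map_pow]
    exact Ideal.mem_map_of_mem ψ hF
  have hE : ψ F = Polynomial.C (B q q q) + Polynomial.C (cubicDeriv B q w) * Polynomial.X +
      Polynomial.C (cubicDeriv B w q) * Polynomial.X ^ 2 +
      Polynomial.C (B w w w) * Polynomial.X ^ 3 := by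
    refine Polynomial.funext fun t => ?_
    rw [hψ, hB.eval_eq]
    have h := cubic_combination (B := B) 1 t 0 0 q w 0 0
    simp only [one_smul, zero_smul, add_zero] at h
    rw [h]
    simp
    ring
  have hc := Polynomial.X_pow_dvd_iff.1 h3
  have c₀ := hc 0 (by norm_num)
  have c₁ := hc 1 (by norm_num)
  have c₂ := hc 2 (by norm_num)
  rw [hE] at c₀ c₁ c₂
  refine ⟨?_, ?_, ?_⟩
  · simpa [Polynomial.coeff_X, Polynomial.coeff_C, Polynomial.coeff_X_pow] using c₀
  · simpa [Polynomial.coeff_X, Polynomial.coeff_C, Polynomial.coeff_X_pow] using c₁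
  · simpa [Polynomial.coeff_X, Polynomial.coeff_C, Polynomial.coeff_X_pow] using c₂

theorem Represents.mem_ideal_sq (hB : Represents B F) {l : Line k}
    {b : Module.Basis (Fin 4) k (Fin 4 → k)} (hl : l.cone = Submodule.span k {b 2, b 3})
    (hs : ∀ c d : k, IsSingularVector B (c • b 2 + d • b 3)) : F ∈ l.ideal ^ 2 := by
  have hy : ∀ i : Fin 4, i ≠ 2 → i ≠ 3 → linForm (b.coord i) ∈ l.ideal := by
    intro i hi₂ hi₃
    refine mem_vanishingIdeal_iff.2 fun x hx => ?_
    rw [hl] at hx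
    obtain ⟨c, d, rfl⟩ := Submodule.mem_span_pair.1 hx
    rw [aeval_eq_eval, eval_linForm]
    simp [hi₂.symm, hi₃.symm]
  have h₂ : IsSingularVector B (b 2) := by simpa using hs 1 0
  have h₃ : IsSingularVector B (b 3) := by simpa using hs 0 1
  -- At `b 2 + b 3` the derivative reduces to this cross term.
  have hp : ∀ w, polar B w (b 2) (b 3) = 0 := by
    intro w
    have h := (hs 1 1).2 w
    have h' := cubicDeriv_combination (B := B) 1 1 0 0 (b 2) (b 3) 0 0 w
    simp [h₂.2, h₃.2] at h h'
    rw [polar_swap_left, polar_swap_right, ← h', h]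
  have h0 := hy 0 (by decide) (by decide)
  have h1 := hy 1 (by decide) (by decide)
  have h00 := Ideal.mul_mem_mul h0 h0
  have h01 := Ideal.mul_mem_mul h0 h1
  have h11 := Ideal.mul_mem_mul h1 h1
  rw [← pow_two] at h00 h01 h11
  have hE := hB.eq_combination b
  simp only [hp, h₂.1, h₃.1, h₂.2, h₃.2, map_zero, zero_mul, add_zero] at hE
  have hE' : F = (C (B (b 0) (b 0) (b 0)) * linForm (b.coord 0) +
        C (cubicDeriv B (b 0) (b 1)) * linForm (b.coord 1) +
        C (cubicDeriv B (b 0) (b 2)) * linForm (b.coord 2) +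
        C (cubicDeriv B (b 0) (b 3)) * linForm (b.coord 3)) *
        (linForm (b.coord 0) * linForm (b.coord 0)) +
      (C (B (b 1) (b 1) (b 1)) * linForm (b.coord 1) +
        C (cubicDeriv B (b 1) (b 0)) * linForm (b.coord 0) +
        C (cubicDeriv B (b 1) (b 2)) * linForm (b.coord 2) +
        C (cubicDeriv B (b 1) (b 3)) * linForm (b.coord 3)) *
        (linForm (b.coord 1) * linForm (b.coord 1)) +
      (C (polar B (b 0) (b 1) (b 2)) * linForm (b.coord 2) +
        C (polar B (b 0) (b 1) (b 3)) * linForm (b.coord 3)) *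
        (linForm (b.coord 0) * linForm (b.coord 1)) := by
    conv_lhs => rw [hE]
    ring
  rw [hE']
  exact add_mem (add_mem (Ideal.mul_mem_left _ _ h00) (Ideal.mul_mem_left _ _ h11))
    (Ideal.mul_mem_left _ _ h01)

/-- Triple vanishing leaves only a cubic in the first two coordinates, which splits. -/
theorem Represents.notMem_ideal_cube [IsAlgClosed k] (hB : Represents B F) (hF : Irreducible F)
    {l : Line k} {b : Module.Basis (Fin 4) k (Fin 4 → k)} (h₂ : b 2 ∈ l.cone) (h₃ : b 3 ∈ l.cone) :
    F ∉ l.ideal ^ 3 := by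
  intro h
  have hv := fun q (hq : q ∈ l.cone) => hB.eq_zero_of_mem_ideal_cube h hq
  have hz := fun q hq => (hv q hq 0).1
  have hd := fun q hq w => (hv q hq w).2.1
  have hD := fun q hq w => (hv q hq w).2.2
  -- `polar B v w q` is the cross term of the quadratic map `v ↦ cubicDeriv B v q`, which vanishes.
  have hp : ∀ q ∈ l.cone, ∀ v w, polar B v w q = 0 := by
    intro q hq v w
    have h' := cubicDeriv_combination (B := B) 1 1 0 0 v w 0 0 q
    simpa [hD q hq, eq_comm] using h'
  refine not_irreducible_binary_cubic (b.coord 0) (b.coord 1) (B (b 0) (b 0) (b 0))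
    (cubicDeriv B (b 0) (b 1)) (cubicDeriv B (b 1) (b 0)) (B (b 1) (b 1) (b 1)) ?_ hF
  have hE := hB.eq_combination b
  simp only [hD _ h₂, hD _ h₃, hd _ h₂, hd _ h₃, hp _ h₂, hp _ h₃, hz _ h₂, hz _ h₃, map_zero,
    zero_mul, add_zero] at hE
  conv_lhs => rw [hE]
  ring

end CubicForm

end CubicSurface

/-- An absolutely irreducible cubic surface with non-isolated singularities (over the algebraic
closure) in positive characteristic has a double line containing all its singular points. -/
theorem mainTheorem7 {K : Type*} [Field K] (p : ℕ) [Fact p.Prime] [CharP K p]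
    (F : MvPolynomial (Fin 4) K) (hdeg : F.IsHomogeneous 3)
    (hirr : Irreducible (MvPolynomial.map (algebraMap K (AlgebraicClosure K)) F))
    (hsing : CubicSurface.HasNonisolatedSingularities
      (MvPolynomial.map (algebraMap K (AlgebraicClosure K)) F)) :
    ∃ l : CubicSurface.Line (AlgebraicClosure K),
      CubicSurface.IsDoubleLine (MvPolynomial.map (algebraMap K (AlgebraicClosure K)) F) l ∧
      ∀ P : CubicSurface.P3 (AlgebraicClosure K),
        CubicSurface.IsSingularPoint
          (MvPolynomial.map (algebraMap K (AlgebraicClosure K)) F) P → l.Contains P := by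
  set F' := MvPolynomial.map (algebraMap K (AlgebraicClosure K)) F
  have : Infinite (AlgebraicClosure K) := IsAlgClosed.instInfinite
  obtain ⟨B, hB⟩ := CubicSurface.exists_represents (hdeg.map (algebraMap K (AlgebraicClosure K)))
  obtain ⟨u, v, hli, hs, hall⟩ := hB.exists_singular_line hirr hsing.infinite
  obtain ⟨x, hx⟩ := CubicSurface.exists_linearIndependent_cons (by norm_num) hli
  obtain ⟨y, hy⟩ := CubicSurface.exists_linearIndependent_cons (by norm_num) hx
  let b := basisOfLinearIndependentOfCardEqFinrank hy (by simp)
  have hb : ⇑b = ![y, x, u, v] := coe_basisOfLinearIndependentOfCardEqFinrank _ _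
  have hb₂ : b 2 = u := by simp [hb]
  have hb₃ : b 3 = v := by simp [hb]
  have hrank : Module.finrank (AlgebraicClosure K)
      (Submodule.span (AlgebraicClosure K) {u, v}) = 2 := by
    have h := finrank_span_eq_card hli
    have hr : Set.range ![u, v] = {u, v} := by simp [Matrix.range_cons, Set.pair_comm]
    rwa [hr, Fintype.card_fin] at h
  refine ⟨⟨Submodule.span _ {u, v}, hrank⟩, ⟨?_, ?_⟩, fun P hP => ?_⟩
  · exact hB.mem_ideal_sq (b := b) (by rw [hb₂, hb₃]) (by rw [hb₂, hb₃]; exact hs)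
  · refine hB.notMem_ideal_cube hirr (b := b) ?_ ?_
    · rw [hb₂]; exact Submodule.subset_span (by simp)
    · rw [hb₃]; exact Submodule.subset_span (by simp)
  · rw [CubicSurface.Line.Contains, Projectivization.submodule_eq, Submodule.span_singleton_le_iff_mem]
    exact hall P hP
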